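/- Let $L$ be a relational language and let $M$ be a countable free homogeneous $L$-structure, i.e. the Fraïssé limit of a free amalgamation class $\mathcal C$ (a Fraïssé class such that, for all $A,B,C\in\mathcal C$ with embeddings of $A$ into $B$ and $C$, the free amalgam of $B$ and $C$ over $A$ is again in $\mathcal C$). Assume that $M$ is non-trivial, i.e. $\mathrm{Aut}(M)\neq\mathrm{Sym}(M)$. Let $M^{<}$ be the linear order expansion of $M$, i.e. the Fraïssé limit of the class of all structures obtained from members of $\mathcal C$ by adding a strict linear order $<$. For finite $A,B,C\subseteq M^{<}$ write $A \perp_B C$ if $A\cap C\subseteq B$, no tuple of elements of $A\cup B\cup C$ that satisfies a relation of $L$ contains both an element of $A\setminus B$ and an element of $C\setminus B$, and for all $a\in A\setminus B$, $c\in C\setminus B$ with $a<c$ there is $b\in B$ with $a<b<c$. Say that $h\in\mathrm{Aut}(M^{<})$ moves almost $R$-maximally (respectively almost $L$-maximally) if for every finite set $X\subseteq M^{<}$, every $n$ and every $n$-tuple $\bar x$ of $M^{<}$, there is a tuple $\bar a$ of $M^{<}$ with $\mathrm{tp}(\bar a/X)=\mathrm{tp}(\bar x/X)$ and $\bar a\perp_X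 h\bar a$ (respectively $h\bar a\perp_X\bar a$). Automorphisms act on the left and $[k,g]=k^{-1}g^{-1}kg$. Let $g\in\mathrm{Aut}(M^{<})$ be such that $ga<a$ for all $a\in M^{<}$. Then there exists $k\in\mathrm{Aut}(M^{<})$ such that $[k,g]$ moves almost $R$-maximally and $[g,k]$ moves almost $L$-maximally. -/

import Mathlib

universe u v w

open FirstOrder

namespace LinExp

open FirstOrder.Language (IsFraisse IsFraisseLimit LHom)
open FirstOrder.Language.Structure (RelMap)

/-! ### Free homogeneous structures -/

section Free

variable {L : FirstOrder.Language.{u, v}}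

/-- `D`, with the embeddings `i : B → D` and `j : C → D`, is the free amalgam of `B` and `C` over
`A`: it is the union of the images of `B` and `C`, these meet only in the image of `A`, and every
related tuple of `D` lies in the image of `B` or in the image of `C`. -/
def IsFreeAmalgam {A B C D : Type w} [L.Structure A] [L.Structure B] [L.Structure C]
    [L.Structure D] (f : A ↪[L] B) (g : A ↪[L] C) (i : B ↪[L] D) (j : C ↪[L] D) : Prop :=
  i.comp f = j.comp g ∧
  Set.range i ∪ Set.range j = Set.univ ∧
  Set.range i ∩ Set.range j ⊆ Set.range (i.comp f) ∧
  ∀ (n : ℕ) (R : L.Relations n) (t : Fin n → D), RelMap R t →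
    Set.range t ⊆ Set.range i ∨ Set.range t ⊆ Set.range j

/-- A free amalgamation class: a Fraïssé class that contains the free amalgam of any two of its
members over a common substructure. -/
def IsFreeAmalgamationClass (K : Set (CategoryTheory.Bundled.{w} L.Structure)) : Prop :=
  IsFraisse K ∧
  ∀ (A B C : CategoryTheory.Bundled.{w} L.Structure) (f : A ↪[L] B) (g : A ↪[L] C),
    A ∈ K → B ∈ K → C ∈ K →
    ∃ D ∈ K, ∃ (i : B ↪[L] D) (j : C ↪[L] D), IsFreeAmalgam f g i j

variable (L)

/-- A countable structure in a relational language is free homogeneous if it is the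
Fraïssé limit of a free amalgamation class. -/
def IsFreeHomogeneous [L.IsRelational] (M : Type w) [L.Structure M] [Countable M] : Prop :=
  ∃ K : Set (CategoryTheory.Bundled.{w} L.Structure),
    IsFreeAmalgamationClass K ∧ IsFraisseLimit K M

/-- `Aut(M) ≠ Sym(M)`: some permutation of `M` is not an automorphism. -/
def IsNontrivial (M : Type w) [L.Structure M] : Prop :=
  ∃ σ : Equiv.Perm M, ¬ ∃ f : M ≃[L] M, ∀ a, f a = σ a

end Free

/-! ### Linear order expansions -/

/-- The relation symbols of the language with one binary relation symbol `<`. -/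
inductive LtRel : ℕ → Type
  | lt : LtRel 2

/-- The relational language `{<}`. -/
def ltLang : FirstOrder.Language.{0, 0} := ⟨fun _ => Empty, LtRel⟩

instance : ltLang.IsRelational := fun _ => inferInstanceAs (IsEmpty Empty)

/-- The language `L ∪ {<}`. -/
abbrev withLt (L : FirstOrder.Language.{u, v}) : FirstOrder.Language.{u, v} := L.sum ltLang

section Expansion

variable (L : FirstOrder.Language.{u, v})

/-- The symbol `<` of the language `L ∪ {<}`. -/
def ltSymb : (withLt L).Relations 2 :=
  (LHom.sumInr : ltLang →ᴸ withLt L).onRelation LtRel.lt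

/-- The interpretation of the symbol `<` in a structure for `L ∪ {<}`. -/
def lt {N : Type w} [(withLt L).Structure N] (a b : N) : Prop :=
  RelMap (ltSymb L) ![a, b]

/-- The interpretation of a symbol of `L` in a structure for `L ∪ {<}`. -/
def rel {N : Type w} [(withLt L).Structure N] {n : ℕ} (R : L.Relations n) (t : Fin n → N) : Prop :=
  RelMap ((LHom.sumInl : L →ᴸ withLt L).onRelation R) t

variable {L} in
/-- The class of all expansions of members of `K` by a strict linear order. -/
def orderExpansions (K : Set (CategoryTheory.Bundled.{w} L.Structure)) :
    Set (CategoryTheory.Bundled.{w} (withLt L).Structure) :=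
  {A | (⟨A, (LHom.sumInl : L →ᴸ withLt L).reduct A⟩ : CategoryTheory.Bundled.{w} L.Structure) ∈ K ∧
    IsStrictTotalOrder A (lt L)}

/-- `N` is the linear order expansion of `M`: the Fraïssé limit of the class of all
expansions of members of the age of `M` by a strict linear order. -/
def IsLinearOrderExpansion [L.IsRelational] (M : Type w) [L.Structure M]
    (N : Type w) [(withLt L).Structure N] [Countable N] : Prop :=
  IsFraisseLimit (orderExpansions (L.age M)) N

/-- The independence relation `A ⫫_B C` on the linear order expansion of a free homogeneous
structure: over `B`, the sets `A` and `C` are freely amalgamated with respect to `L` (they are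
disjoint outside `B`, and no related tuple from `A ∪ B ∪ C` meets both `A \ B` and `C \ B`), and
`a < c` with `a ∈ A \ B`, `c ∈ C \ B` only if an element of `B` lies in between. -/
def Indep {N : Type w} [(withLt L).Structure N] (A B C : Set N) : Prop :=
  A ∩ C ⊆ B ∧
  (∀ (n : ℕ) (R : L.Relations n) (t : Fin n → N), Set.range t ⊆ A ∪ B ∪ C → rel L R t →
    ¬ ((∃ i, t i ∈ A \ B) ∧ ∃ j, t j ∈ C \ B)) ∧
  ∀ a ∈ A \ B, ∀ c ∈ C \ B, lt L a c → ∃ b ∈ B, lt L a b ∧ lt L b c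

end Expansion

/-! ### Types and automorphisms that move almost maximally -/

section Moves

variable {L : FirstOrder.Language.{u, v}} {N : Type w} [L.Structure N]

variable (L) in
/-- The complete type `tp(x/X)` of a tuple `x` over a set `X`. -/
def tp {n : ℕ} (x : Fin n → N) (X : Set N) : Set ((L[[X]]).Formula (Fin n)) :=
  {φ | φ.Realize x}

/-- `g` moves almost `R`-maximally with respect to the ternary relation `Ind`: every type of a
finite tuple over a finite set `X` has a realisation `a` with `a ⫫_X g a`. -/
def MovesAlmostRMaximally (Ind : Set N → Set N → Set N → Prop) (g : N ≃[L] N) : Prop :=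
  ∀ (X : Set N), X.Finite → ∀ (n : ℕ) (x : Fin n → N),
    ∃ a : Fin n → N, tp L a X = tp L x X ∧ Ind (Set.range a) X (Set.range (g ∘ a))

/-- `g` moves almost `L`-maximally with respect to the ternary relation `Ind`: every type of a
finite tuple over a finite set `X` has a realisation `a` with `g a ⫫_X a`. -/
def MovesAlmostLMaximally (Ind : Set N → Set N → Set N → Prop) (g : N ≃[L] N) : Prop :=
  ∀ (X : Set N), X.Finite → ∀ (n : ℕ) (x : Fin n → N),
    ∃ a : Fin n → N, tp L a X = tp L x X ∧ Ind (Set.range (g ∘ a)) X (Set.range a)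

/-- The commutator `[k, g] = k⁻¹ g⁻¹ k g`, where automorphisms act on the left. -/
def comm (k g : N ≃[L] N) : N ≃[L] N :=
  k.symm.comp (g.symm.comp (k.comp g))

end Moves

end LinExp

namespace LinExp

open FirstOrder.Language (IsFraisse IsFraisseLimit LHom)
open FirstOrder.Language.Structure (RelMap)

/-! ### Permutation groups of ordered hypergraphs -/

section Hypergraph

variable {N : Type w}

/-! The problem is one about a closed group of order automorphisms of a hypergraph, whose edges are
the ranges of related tuples. The only input from model theory is `IsFreelyHomogeneous`: over a
finite set, a point can be moved to be free from any given finite set, inside any cut compatible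
with its type. For `relAut` this holds because the order expansion can amalgamate freely in `L`
while ordering the amalgam at will.

Put `γ = g⁻¹`, which moves every point up. Writing `a = γ b`, independence of `a` and `[k, g] a`
over `X` says that `γ b` is independent from `k⁻¹ γ k b` over `γ Y`, where `Y = g X`. The
automorphism `k` is built by finite approximations. At each stage `b` is chosen free over `Y` and
just below the next point of `Y`, as seen from the finite data so far (`exists_squeeze`). The value
`k⁻¹ γ k b` is still undetermined, so it can be made free from `γ b` and put just above the
preceding point already in use. Any such point that separates it from `γ b` then yields a point of
`γ Y` in between (`exists_indep_conj`). Reversing the order handles `[g, k]`, and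
`exists_forall_of_forced` meets the countably many requirements with one `k`. -/

theorem apply_inv_self_perm (σ : Equiv.Perm N) (x : N) : σ (σ⁻¹ x) = x :=
  Equiv.apply_symm_apply σ x

theorem inv_apply_self_perm (σ : Equiv.Perm N) (x : N) : σ⁻¹ (σ x) = x :=
  Equiv.symm_apply_apply σ x

/-- The reverse of a linear order. -/
abbrev reverseOrder (i : LinearOrder N) : LinearOrder N :=
  inferInstanceAs (LinearOrder Nᵒᵈ)

/-- Over `S`, the set `P` is free from `T`: no edge contained in `T ∪ P` meets both `P` and
`T \ S`. -/
def FreeFrom (E : Set (Set N)) (P T S : Set N) : Prop :=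
  ∀ s ∈ E, s ⊆ T ∪ P → (s ∩ P).Nonempty → Disjoint s (T \ S)

/-- The independence relation of an ordered hypergraph. -/
def EdgeIndep [LT N] (E : Set (Set N)) (A B C : Set N) : Prop :=
  A ∩ C ⊆ B ∧
  (∀ s ∈ E, s ⊆ A ∪ B ∪ C → ¬ ((s ∩ (A \ B)).Nonempty ∧ (s ∩ (C \ B)).Nonempty)) ∧
  ∀ a ∈ A \ B, ∀ c ∈ C \ B, a < c → ∃ b ∈ B, a < b ∧ b < c

/-- Only the order clause is asymmetric. This symmetry lets the statement about `[g, k]` reuse the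
argument for `[k, g]`. -/
theorem EdgeIndep.swap {i : LinearOrder N} {E : Set (Set N)} {A B C : Set N}
    (h : @EdgeIndep N (reverseOrder i).toLT E A B C) : EdgeIndep E C B A := by
  refine ⟨fun x hx => h.1 ⟨hx.2, hx.1⟩, fun s hs hsub hm => h.2.1 s hs ?_ hm.symm, ?_⟩
  · intro x hx
    rcases hsub hx with (h | h) | h
    exacts [Or.inr h, Or.inl (Or.inr h), Or.inl (Or.inl h)]
  · intro a ha c hc hac
    obtain ⟨b, hb, h1, h2⟩ := h.2.2 c hc a ha hac
    exact ⟨b, hb, h2, h1⟩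

theorem EdgeIndep.mono [LT N] {E : Set (Set N)} {A A' B C C' : Set N} (h : EdgeIndep E A B C)
    (hA : A' ⊆ A) (hC : C' ⊆ C) : EdgeIndep E A' B C' := by
  refine ⟨fun x hx => h.1 ⟨hA hx.1, hC hx.2⟩, fun s hs hsub hm => h.2.1 s hs ?_ ⟨?_, ?_⟩, ?_⟩
  · exact hsub.trans (Set.union_subset_union (Set.union_subset_union_left _ hA) hC)
  · exact hm.1.mono (Set.inter_subset_inter_right _ (Set.sdiff_subset_sdiff_left hA))
  · exact hm.2.mono (Set.inter_subset_inter_right _ (Set.sdiff_subset_sdiff_left hC))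
  · exact fun a ha c hc => h.2.2 a ⟨hA ha.1, ha.2⟩ c ⟨hC hc.1, hc.2⟩

/-- A group of automorphisms of an ordered hypergraph in which every point outside a finite set
`S` can be moved, over `S`, to a point that is free from a given finite set and lies in a
prescribed interval. -/
structure IsFreelyHomogeneous [LinearOrder N] (A : Subgroup (Equiv.Perm N)) (E : Set (Set N)) :
    Prop where
  strictMono : ∀ σ ∈ A, StrictMono σ
  edge : ∀ σ ∈ A, ∀ s ∈ E, σ '' s ∈ E
  exists_free : ∀ (S T Lo Hi : Set N) (a : N), T.Finite → Lo.Finite → Hi.Finite → S ⊆ T → a ∉ S →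
    (∀ l ∈ Lo, ∀ h ∈ Hi, l < h) → (∀ s ∈ S, s < a → ∀ h ∈ Hi, s < h) →
    (∀ s ∈ S, a < s → ∀ l ∈ Lo, l < s) →
    ∃ σ ∈ A, (∀ s ∈ S, σ s = s) ∧ σ a ∉ T ∧ FreeFrom E {σ a} T S ∧
      (∀ l ∈ Lo, l < σ a) ∧ ∀ h ∈ Hi, σ a < h

theorem IsFreelyHomogeneous.swap {i : LinearOrder N} {A : Subgroup (Equiv.Perm N)}
    {E : Set (Set N)} (h : IsFreelyHomogeneous A E) :
    @IsFreelyHomogeneous N (reverseOrder i) A E := by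
  refine @IsFreelyHomogeneous.mk N (reverseOrder i) A E
    (fun σ hσ a b hab => h.strictMono σ hσ hab) h.edge ?_
  intro S T Lo Hi a hT hLo hHi hST ha h1 h2 h3
  obtain ⟨σ, hσ, hS, haT, hfree, hl, hh⟩ := h.exists_free S T Hi Lo a hT hHi hLo hST ha
    (fun l hl h hh => h1 h hh l hl) h3 h2
  exact ⟨σ, hσ, hS, haT, hfree, hh, hl⟩

/-- A finite set can be moved over `Y` to a set that is free from `T` over `Y`, and whose points
lie so close to the next point of `Y` that no point of `Z`, and no image of one of them under a
decreasing map, is in between. -/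
theorem IsFreelyHomogeneous.exists_squeeze [LinearOrder N] {A : Subgroup (Equiv.Perm N)}
    {E : Set (Set N)} (h : IsFreelyHomogeneous A E) {Y T Z : Set N} (hT : T.Finite)
    (hZ : Z.Finite) (hYT : Y ⊆ T) {δ : N → N} (hδ : ∀ z, δ z < z) (U : Finset N)
    (hU : ∀ u ∈ U, u ∉ Y) :
    ∃ σ ∈ A, (∀ y ∈ Y, σ y = y) ∧ (∀ u ∈ U, σ u ∉ T) ∧ FreeFrom E (σ '' U) T Y ∧
      ∀ u ∈ U, ∀ z, (z ∈ Z ∨ ∃ u' ∈ U, z = δ (σ u')) → σ u ≤ z → ∃ y ∈ Y, σ u < y ∧ y ≤ z := by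
  classical
  have hY : Y.Finite := hT.subset hYT
  induction U using Finset.induction_on_min with
  | empty => exact ⟨1, A.one_mem, by simp, by simp, by simp [FreeFrom], by simp⟩
  -- Points are placed from the top down: `a` lies below all of `U`, whose images are already in
  -- place.
  | insert a U ha ih =>
    obtain ⟨σ, hσ, hσY, hσT, hσF, hσZ⟩ := ih fun u hu => hU u (Finset.mem_insert_of_mem hu)
    have hm := h.strictMono σ hσ
    have haY : a ∉ Y := hU a (Finset.mem_insert_self _ _)
    have hfin : (σ '' (U : Set N)).Finite := U.finite_toSet.image _
    have hlt : ∀ y ∈ Y, y < σ a ↔ y < a := fun y hy => by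
      conv_lhs => rw [← hσY y hy]
      exact hm.lt_iff_lt
    have hgt : ∀ y ∈ Y, σ a < y ↔ a < y := fun y hy => by
      conv_lhs => rw [← hσY y hy]
      exact hm.lt_iff_lt
    -- The new point must exceed each forbidden value not separated from `a` by a point of `Y`, yet
    -- stay below the earlier images and the points of `Y` above `a`. Such a cut exists because the
    -- earlier images are already squeezed.
    obtain ⟨τ, hτ, hτS, hτT, hτF, hτL, hτH⟩ := h.exists_free (Y ∪ σ '' U) (T ∪ σ '' U)
      ({y ∈ Y | y < a} ∪ {z ∈ Z ∪ (fun u => δ (σ u)) '' U | ¬ ∃ y ∈ Y, a < y ∧ y ≤ z})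
      ({y ∈ Y | a < y} ∪ σ '' U) (σ a) (hT.union hfin)
      ((hY.subset (Set.sep_subset _ _)).union
        ((hZ.union (U.finite_toSet.image _)).subset (Set.sep_subset _ _)))
      ((hY.subset (Set.sep_subset _ _)).union hfin) (Set.union_subset_union_left _ hYT)
      (by
        rintro (hy | ⟨u, hu, hua⟩)
        · have : σ a = a := σ.injective (hσY _ hy)
          exact haY (this ▸ hy)
        · exact (ha u hu).ne' (σ.injective hua))
      (by
        rintro l (⟨hl, hla⟩ | ⟨hl, hbad⟩) t (⟨ht, hta⟩ | ⟨u, hu, rfl⟩)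
        · exact hla.trans hta
        · rw [← hσY l hl]; exact hm (hla.trans (ha u hu))
        · by_contra hc
          exact hbad ⟨t, ht, hta, not_lt.1 hc⟩
        · by_contra hc
          obtain ⟨y, hy, h1, h2⟩ := hσZ u hu l
            (by
              rcases hl with hl | ⟨u', hu', rfl⟩
              exacts [Or.inl hl, Or.inr ⟨u', hu', rfl⟩]) (not_lt.1 hc)
          refine hbad ⟨y, hy, (hgt y hy).1 ((hm (ha u hu)).trans h1), h2⟩)
      (by
        rintro s (hs | ⟨u, hu, rfl⟩) hsa t ht
        · rcases ht with ⟨ht, hta⟩ | ⟨u, hu, rfl⟩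
          · exact ((hlt s hs).1 hsa).trans hta
          · exact hsa.trans (hm (ha u hu))
        · exact absurd (hm (ha u hu)) hsa.not_gt)
      (by
        rintro s hs hsa l (⟨hl, hla⟩ | ⟨hl, hbad⟩)
        · exact ((hlt l hl).2 hla).trans hsa
        · rcases hs with hs | ⟨u, hu, rfl⟩
          · by_contra hc
            exact hbad ⟨s, hs, (hgt s hs).1 hsa, not_lt.1 hc⟩
          · by_contra hc
            obtain ⟨y, hy, h1, h2⟩ := hσZ u hu l
              (by
                rcases hl with hl | ⟨u', hu', rfl⟩
                exacts [Or.inl hl, Or.inr ⟨u', hu', rfl⟩]) (not_lt.1 hc)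
            exact hbad ⟨y, hy, (hgt y hy).1 (hsa.trans h1), h2⟩)
    have hU' : ∀ u ∈ U, τ (σ u) = σ u := fun u hu => hτS _ (Or.inr ⟨u, hu, rfl⟩)
    have hlow : ∀ u ∈ U, τ (σ a) < σ u := fun u hu => hτH _ (Or.inr ⟨u, hu, rfl⟩)
    have himg : (τ * σ) '' (insert a U : Finset N) = {τ (σ a)} ∪ σ '' U := by
      ext x
      simp only [Finset.coe_insert, Set.mem_image, Set.mem_insert_iff, Set.mem_union,
        Set.mem_singleton_iff, Equiv.Perm.mul_apply, Finset.mem_coe]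
      constructor
      · rintro ⟨y, rfl | hy, rfl⟩
        exacts [Or.inl rfl, Or.inr ⟨y, hy, (hU' y hy).symm⟩]
      · rintro (rfl | ⟨y, hy, rfl⟩)
        exacts [⟨a, Or.inl rfl, rfl⟩, ⟨y, Or.inr hy, hU' y hy⟩]
    refine ⟨τ * σ, A.mul_mem hτ hσ, fun y hy => ?_, ?_, ?_, ?_⟩
    · rw [Equiv.Perm.mul_apply, hσY y hy, hτS y (Or.inl hy)]
    · intro u hu
      rcases Finset.mem_insert.1 hu with rfl | hu
      · exact fun hc => hτT (Or.inl hc)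
      · rw [Equiv.Perm.mul_apply, hU' u hu]; exact hσT u hu
    · rw [himg]
      intro s hs hsub hne
      -- An edge through the new point is controlled by its freeness over `Y ∪ σ '' U`; any other
      -- edge falls under the induction hypothesis.
      by_cases hmem : τ (σ a) ∈ s
      · refine (hτF s hs (fun x hx => ?_) ⟨_, hmem, rfl⟩).mono_right ?_
        · rcases hsub hx with hx | hx | hx
          exacts [Or.inl (Or.inl hx), Or.inr hx, Or.inl (Or.inr hx)]
        · rintro x ⟨hx, hxY⟩
          refine ⟨Or.inl hx, ?_⟩
          rintro (hx' | ⟨u, hu, rfl⟩)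
          exacts [hxY hx', hσT u hu hx]
      · have key : ∀ x ∈ s, x ∈ ({τ (σ a)} : Set N) ∪ σ '' U → x ∈ σ '' (U : Set N) := by
          rintro x hx (rfl | hx')
          exacts [absurd hx hmem, hx']
        refine hσF s hs (fun x hx => ?_) ?_
        · exact (hsub hx).imp_right (key x hx)
        · obtain ⟨x, hx, hx'⟩ := hne
          exact ⟨x, hx, key x hx hx'⟩
    · intro u hu z hz hle
      have hself : τ (σ a) ≤ z → (z ∈ Z ∨ ∃ u' ∈ U, z = δ (σ u')) →
          ∃ y ∈ Y, τ (σ a) < y ∧ y ≤ z := by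
        intro hle hz
        by_contra hc
        refine hle.not_gt (hτL z (Or.inr ⟨?_, ?_⟩))
        · rcases hz with hz | ⟨u', hu', rfl⟩
          exacts [Or.inl hz, Or.inr ⟨u', hu', rfl⟩]
        · rintro ⟨y, hy, hay, hyz⟩
          exact hc ⟨y, hy, hτH y (Or.inl ⟨hy, hay⟩), hyz⟩
      -- The value of `δ` at the new point was not available as a lower bound, but it lies below
      -- that point and hence below all images of `U`.
      have hz' : z ∈ Z ∨ z = δ (τ (σ a)) ∨ ∃ u' ∈ U, z = δ (σ u') := by
        refine hz.imp_right ?_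
        rintro ⟨u', hu', rfl⟩
        rcases Finset.mem_insert.1 hu' with rfl | hu'
        · exact Or.inl rfl
        · exact Or.inr ⟨u', hu', by rw [Equiv.Perm.mul_apply, hU' u' hu']⟩
      rw [Equiv.Perm.mul_apply] at hle ⊢
      rcases Finset.mem_insert.1 hu with rfl | hu
      · rcases hz' with hz | rfl | hz
        · exact hself hle (Or.inl hz)
        · exact absurd hle (hδ _).not_ge
        · exact hself hle (Or.inr hz)
      · rw [hU' u hu] at hle ⊢
        rcases hz' with hz | rfl | hz
        · exact hσZ u hu z (Or.inl hz) hle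
        · exact absurd (hle.trans_lt (hδ _)) (hlow u hu).not_gt
        · exact hσZ u hu z (Or.inr hz) hle

/-- Every finite approximation of an automorphism `k` extends to one that forces
`γ A ⫫_{γ Y} (k⁻¹ γ k) A` for some set `A` of the form `Y ∪ ρ U` with `ρ` fixing `Y`. -/
theorem IsFreelyHomogeneous.exists_indep_conj [LinearOrder N] {A : Subgroup (Equiv.Perm N)}
    {E : Set (Set N)} (h : IsFreelyHomogeneous A E) {γ : Equiv.Perm N} (hγA : γ ∈ A)
    (hγ : ∀ z, z < γ z) {σ : Equiv.Perm N} (hσ : σ ∈ A) {D Y : Set N} (hD : D.Finite)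
    (hY : Y.Finite) (U : Finset N) (hU : ∀ u ∈ U, u ∉ Y) :
    ∃ σ' ∈ A, ∃ D' : Set N, D'.Finite ∧ (∀ x ∈ D, σ' x = σ x) ∧
      ∃ ρ ∈ A, (∀ y ∈ Y, ρ y = y) ∧ ∀ k : Equiv.Perm N, (∀ x ∈ D', k x = σ' x) →
        EdgeIndep E (γ '' (Y ∪ ρ '' U)) (γ '' Y) ((k⁻¹ * γ * k) '' (Y ∪ ρ '' U)) := by
  classical
  have hγ' : ∀ z, γ⁻¹ z < z := fun z => by simpa using hγ (γ⁻¹ z)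
  have hγm := h.strictMono γ hγA
  -- Keeping `σ` on `D₁` fixes the values of `k⁻¹ γ k` on `Y`, since `D₁` contains both `Y` and
  -- these values.
  set D₁ := D ∪ Y ∪ γ '' Y ∪ (σ⁻¹ * γ * σ) '' Y 
  have hD₁ : D₁.Finite := ((hD.union hY).union (hY.image _)).union (hY.image _)
  have hYD : Y ⊆ D₁ := fun y hy => Or.inl (Or.inl (Or.inr hy))
  have hγYD : γ '' Y ⊆ D₁ := fun y hy => Or.inl (Or.inr hy)
  have hθYD : (σ⁻¹ * γ * σ) '' Y ⊆ D₁ := fun y hy => Or.inr hy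
  have hinv : ∀ {B : Set N} {x}, γ x ∈ B → x ∈ (γ⁻¹ : Equiv.Perm N) '' B := fun {B x} hx => ⟨γ x, hx, by simp⟩
  -- Including the preimage of `D₁` under `γ` makes `γ '' (ρ '' U)` free from `D₁` over `γ '' Y`
  -- after translation by `γ`.
  obtain ⟨ρ, hρ, hρY, hρT, hρF, hρZ⟩ := h.exists_squeeze (Y := Y) (T := D₁ ∪ (γ⁻¹ : Equiv.Perm N) '' D₁)
    (Z := D₁ ∪ (γ⁻¹ : Equiv.Perm N) '' D₁) (hD₁.union (hD₁.image _)) (hD₁.union (hD₁.image _))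
    (hYD.trans Set.subset_union_left) hγ' U hU
  have hR : (σ '' D₁).Finite := hD₁.image _
  -- Changing `σ` off `D₁` keeps `γ (σ₁ (ρ u))` outside `σ₁ '' (D₁ ∪ ρ '' U)`, so its preimage under
  -- `σ₁` can still be moved.
  obtain ⟨τ, hτ, hτY, hτT, -, hτZ⟩ := h.exists_squeeze (Y := σ '' D₁)
    (T := σ '' D₁ ∪ (γ⁻¹ : Equiv.Perm N) '' (σ '' D₁)) (Z := ∅) (hR.union (hR.image _)) Set.finite_empty
    Set.subset_union_left hγ' (U.image fun u => σ (ρ u)) (by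
      simp only [Finset.mem_image]
      rintro _ ⟨u, hu, rfl⟩ ⟨d, hd, hdu⟩
      exact hρT u hu (Or.inl (σ.injective hdu ▸ hd)))
  have hσ₁D : ∀ x ∈ D₁, (τ * σ) x = σ x := fun x hx => hτY _ ⟨x, hx, rfl⟩
  set σ₁ := τ * σ
  have hσ₁ : σ₁ ∈ A := A.mul_mem hτ hσ
  have hwR : ∀ u ∈ U, γ (σ₁ (ρ u)) ∉ σ '' D₁ := fun u hu hc =>
    hτT _ (Finset.mem_image_of_mem _ hu) (Or.inr (hinv hc))
  have hww : ∀ u ∈ U, ∀ u' ∈ U, γ (σ₁ (ρ u)) ≠ σ₁ (ρ u') := by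
    intro u hu u' hu' he
    have he' : τ (σ (ρ u)) = γ⁻¹ (τ (σ (ρ u'))) := by
      apply γ.injective
      rw [apply_inv_self_perm]
      exact he
    obtain ⟨y, -, h1, h2⟩ := hτZ _ (Finset.mem_image_of_mem _ hu) _
      (Or.inr ⟨_, Finset.mem_image_of_mem _ hu', rfl⟩) he'.le
    rw [← he'] at h2
    exact h1.not_ge h2
  have huu : ∀ u ∈ U, ∀ u' ∈ U, γ (ρ u) ≠ ρ u' := by
    intro u hu u' hu' he
    have he' : ρ u = γ⁻¹ (ρ u') := by rw [← he, inv_apply_self_perm]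
    obtain ⟨y, -, h1, h2⟩ := hρZ _ hu _ (Or.inr ⟨_, hu', rfl⟩) he'.le
    rw [← he'] at h2
    exact h1.not_ge h2
  have hρfin : (ρ '' (U : Set N)).Finite := U.finite_toSet.image _
  have hsw := h.swap
  -- In the reversed order the squeeze puts `v u`, the future value of `k⁻¹ γ k` at `ρ u`, just
  -- above the preceding point of `D₁ ∪ ρ '' U`.
  obtain ⟨κ, hκ, hκY, hκT, hκF, hκZ⟩ := @IsFreelyHomogeneous.exists_squeeze N
    (reverseOrder inferInstance) A E hsw
    (D₁ ∪ ρ '' U) (D₁ ∪ ρ '' U ∪ γ '' (ρ '' U)) (γ '' (ρ '' U))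
    ((hD₁.union hρfin).union (hρfin.image _)) (hρfin.image _) Set.subset_union_left γ hγ
    (U.image fun u => σ₁⁻¹ (γ (σ₁ (ρ u)))) (by
      simp only [Finset.mem_image]
      rintro _ ⟨u, hu, rfl⟩ (hc | ⟨u', hu', hc⟩)
      · refine hwR u hu ⟨_, hc, ?_⟩
        rw [← hσ₁D _ hc, apply_inv_self_perm]
      · refine hww u hu u' hu' ?_
        rw [hc, apply_inv_self_perm])
  set v : N → N := fun u => κ (σ₁⁻¹ (γ (σ₁ (ρ u)))) with hvdef
  have hvT : ∀ u ∈ U, v u ∉ D₁ ∪ ρ '' U ∪ γ '' (ρ '' U) := fun u hu =>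
    hκT _ (Finset.mem_image_of_mem _ hu)
  have hvF : FreeFrom E (v '' U) (D₁ ∪ ρ '' U ∪ γ '' (ρ '' U)) (D₁ ∪ ρ '' U) := by
    convert hκF using 1
    rw [Finset.coe_image, Set.image_image]
  have hvZ : ∀ u ∈ U, ∀ u' ∈ U, γ (ρ u') ≤ v u → ∃ t ∈ D₁ ∪ ρ '' U, γ (ρ u') ≤ t ∧ t < v u := by
    intro u hu u' hu' hle
    obtain ⟨t, ht, h1, h2⟩ := hκZ _ (Finset.mem_image_of_mem _ hu) (γ (ρ u'))
      (Or.inl ⟨_, ⟨u', hu', rfl⟩, rfl⟩) hle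
    exact ⟨t, ht, h2, h1⟩
  have hσ₂ : ∀ x ∈ D₁ ∪ ρ '' U, (σ₁ * κ⁻¹) x = σ₁ x := fun x hx => by
    rw [Equiv.Perm.mul_apply]
    congr 1
    rw [Equiv.Perm.inv_eq_iff_eq]
    exact (hκY x hx).symm
  -- Composing with `κ⁻¹` preserves `σ₁` on `D₁ ∪ ρ '' U` and sends `v u` to `γ (σ₁ (ρ u))`.
  refine ⟨σ₁ * κ⁻¹, A.mul_mem hσ₁ (A.inv_mem hκ), D₁ ∪ ρ '' U ∪ v '' U,
    (hD₁.union hρfin).union (U.finite_toSet.image _), fun x hx => ?_, ρ, hρ, hρY, ?_⟩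
  · have hx' : x ∈ D₁ := Or.inl (Or.inl (Or.inl hx))
    rw [hσ₂ x (Or.inl hx'), hσ₁D x hx']
  intro k hk
  have hkD : ∀ x ∈ D₁, k x = σ x := fun x hx => by
    rw [hk x (Or.inl (Or.inl hx)), hσ₂ x (Or.inl hx), hσ₁D x hx]
  have hθY : ∀ y ∈ Y, (k⁻¹ * γ * k) y = (σ⁻¹ * γ * σ) y := fun y hy => by
    have := hkD _ (hθYD ⟨y, hy, rfl⟩)
    simp only [Equiv.Perm.mul_apply] at this ⊢
    rw [apply_inv_self_perm] at this
    rw [hkD y (hYD hy), Equiv.Perm.inv_eq_iff_eq]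
    exact this.symm
  have hθu : ∀ u ∈ U, (k⁻¹ * γ * k) (ρ u) = v u := fun u hu => by
    have h1 : k (ρ u) = σ₁ (ρ u) := by
      rw [hk _ (Or.inl (Or.inr ⟨u, hu, rfl⟩)), hσ₂ _ (Or.inr ⟨u, hu, rfl⟩)]
    have h2 : k (v u) = γ (σ₁ (ρ u)) := by
      rw [hk _ (Or.inr ⟨u, hu, rfl⟩)]
      simp [hvdef]
    simp only [Equiv.Perm.mul_apply]
    rw [h1, ← h2, inv_apply_self_perm]
  have hC : ∀ c ∈ (k⁻¹ * γ * k) '' (Y ∪ ρ '' U), c ∈ D₁ ∨ ∃ u ∈ U, c = v u := by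
    rintro _ ⟨y, hy | ⟨u, hu, rfl⟩, rfl⟩
    · rw [hθY y hy]; exact Or.inl (hθYD ⟨y, hy, rfl⟩)
    · exact Or.inr ⟨u, hu, hθu u hu⟩
  have hA : ∀ a ∈ γ '' (Y ∪ ρ '' U) \ γ '' Y, ∃ u ∈ U, a = γ (ρ u) := by
    rintro _ ⟨⟨y, hy | ⟨u, hu, rfl⟩, rfl⟩, ha⟩
    · exact absurd ⟨y, hy, rfl⟩ ha
    · exact ⟨u, hu, rfl⟩
  have hγu : ∀ u ∈ U, γ (ρ u) ∉ D₁ := fun u hu hc => hρT u hu (Or.inr (hinv hc))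
  refine ⟨?_, ?_, ?_⟩
  · rintro x ⟨hxA, hxC⟩
    by_contra hxB
    obtain ⟨u, hu, rfl⟩ := hA x ⟨hxA, hxB⟩
    rcases hC _ hxC with hx | ⟨u', hu', hx⟩
    · exact hγu u hu hx
    · exact hvT u' hu' (hx ▸ Or.inr ⟨_, ⟨u, hu, rfl⟩, rfl⟩)
  · rintro s hs hsub ⟨⟨a, has, ha⟩, ⟨c, hcs, hc⟩⟩
    obtain ⟨u, hu, rfl⟩ := hA a ha
    have hAT : ∀ x ∈ γ '' (Y ∪ ρ '' U) ∪ γ '' Y, x ∈ D₁ ∨ x ∈ γ '' (ρ '' U) := by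
      rintro x (⟨y, hy | hy, rfl⟩ | hx)
      exacts [Or.inl (hγYD ⟨y, hy, rfl⟩), Or.inr ⟨y, hy, rfl⟩, Or.inl (hγYD hx)]
    -- An edge through some `v u'` contradicts the freeness of `v '' U`; any other edge is pulled
    -- back by `γ` to contradict that of `ρ '' U`.
    by_cases hv : ∃ u' ∈ U, v u' ∈ s
    · obtain ⟨u', hu', hv⟩ := hv
      refine Set.disjoint_left.1 (hvF s hs ?_ ⟨_, hv, ⟨u', hu', rfl⟩⟩) has
        ⟨Or.inr ⟨_, ⟨u, hu, rfl⟩, rfl⟩, ?_⟩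
      · intro x hx
        rcases hsub hx with hx | hx
        · exact Or.inl ((hAT x hx).imp_left Or.inl)
        · rcases hC x hx with hx | ⟨u', hu', rfl⟩
          exacts [Or.inl (Or.inl (Or.inl hx)), Or.inr ⟨u', hu', rfl⟩]
      · rintro (hx | ⟨u', hu', hx⟩)
        exacts [hγu u hu hx, huu u hu u' hu' hx.symm]
    · push Not at hv
      have hsD : ∀ x ∈ s, x ∈ D₁ ∨ x ∈ γ '' (ρ '' U) := by
        intro x hx
        rcases hsub hx with hx' | hx'
        · exact hAT x hx'
        · rcases hC x hx' with hx' | ⟨u', hu', rfl⟩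
          exacts [Or.inl hx', absurd hx (hv u' hu')]
      have hcD : c ∈ D₁ := by
        rcases hC c hc.1 with hx' | ⟨u', hu', rfl⟩
        exacts [hx', absurd hcs (hv u' hu')]
      refine Set.disjoint_left.1 (hρF ((γ⁻¹ : Equiv.Perm N) '' s) (h.edge _ (A.inv_mem hγA) s hs) ?_
        ⟨ρ u, ⟨_, has, by simp⟩, ⟨u, hu, rfl⟩⟩) ⟨c, hcs, rfl⟩ ⟨Or.inr ⟨c, hcD, rfl⟩, ?_⟩
      · rintro _ ⟨x, hx, rfl⟩
        rcases hsD x hx with hx | ⟨y, hy, rfl⟩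
        · exact Or.inl (Or.inr ⟨x, hx, rfl⟩)
        · right; simpa using hy
      · exact fun hc' => hc.2 ⟨_, hc', by simp⟩
  · intro a ha c hc hac
    obtain ⟨u, hu, rfl⟩ := hA a ha
    rcases hC c hc.1 with hcD | ⟨u', hu', rfl⟩
    · obtain ⟨y, hy, h1, h2⟩ := hρZ u hu (γ⁻¹ c) (Or.inl (Or.inr ⟨c, hcD, rfl⟩)) (by
        rw [← hγm.le_iff_le]; simpa using hac.le)
      refine ⟨γ y, ⟨y, hy, rfl⟩, hγm h1, lt_of_le_of_ne ?_ ?_⟩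
      · rw [← hγm.le_iff_le] at h2; simpa using h2
      · rintro rfl; exact hc.2 ⟨y, hy, rfl⟩
    -- The squeeze of `v u'` gives a separating `t` in `D₁ ∪ ρ '' U`; the squeeze of `ρ u` below the
    -- preimage of `t` under `γ` then gives the point of `Y`.
    · obtain ⟨t, ht, h1, h2⟩ := hvZ u' hu' u hu hac.le
      obtain ⟨y, hy, h3, h4⟩ := hρZ u hu (γ⁻¹ t) (by
          rcases ht with ht | ⟨u', hu', rfl⟩
          exacts [Or.inl (Or.inr ⟨t, ht, rfl⟩), Or.inr ⟨u', hu', rfl⟩]) (by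
        rw [← hγm.le_iff_le]; simpa using h1)
      refine ⟨γ y, ⟨y, hy, rfl⟩, hγm h3, lt_of_le_of_lt ?_ h2⟩
      rw [← hγm.le_iff_le] at h4; simpa using h4

end Hypergraph

/-! ### Limits of approximations -/

/-- If the group `A` of permutations of a countable set is closed, and every finite approximation
of an element of `A` extends to one that forces `P i`, then some element of `A` has all the
properties `P i`. -/
theorem exists_forall_of_forced {N : Type w} [Countable N] {A : Subgroup (Equiv.Perm N)}
    (hA : ∀ k : Equiv.Perm N, (∀ D : Set N, D.Finite → ∃ σ ∈ A, ∀ x ∈ D, k x = σ x) → k ∈ A)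
    {ι : Type*} [Countable ι] (P : ι → Equiv.Perm N → Prop)
    (hP : ∀ i, ∀ σ ∈ A, ∀ D : Set N, D.Finite → ∃ σ' ∈ A, ∃ D' : Set N, D'.Finite ∧
      (∀ x ∈ D, σ' x = σ x) ∧ ∀ k : Equiv.Perm N, (∀ x ∈ D', k x = σ' x) → P i k) :
    ∃ k ∈ A, ∀ i, P i k := by
  -- The tasks `inr x` put `x` in the domain and in the range of the limit. Every task persists once
  -- met, so treating each at least once suffices.
  let Q : ι ⊕ N → A × Finset N → Prop := fun j s => match j with
    | .inl i => ∀ k : Equiv.Perm N, (∀ x ∈ s.2, k x = s.1.1 x) → P i k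
    | .inr x => x ∈ s.2 ∧ s.1.1⁻¹ x ∈ s.2
  have hQ : ∀ j (s : A × Finset N), ∃ s' : A × Finset N,
      s.2 ⊆ s'.2 ∧ (∀ x ∈ s.2, s'.1.1 x = s.1.1 x) ∧ Q j s' := by
    classical
    rintro (i | x) ⟨⟨σ, hσ⟩, D⟩
    · obtain ⟨σ', hσ', D', hD', hag, hk⟩ := hP i σ hσ D D.finite_toSet
      exact ⟨(⟨σ', hσ'⟩, D ∪ hD'.toFinset), Finset.subset_union_left, hag,
        fun k h => hk k fun x hx => h x (by simp [hx])⟩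
    · exact ⟨(⟨σ, hσ⟩, insert x (insert (σ⁻¹ x) D)), fun y hy => by simp [hy], fun _ _ => rfl,
        by simp, by simp⟩
  choose next hsub hag hnext using hQ
  rcases isEmpty_or_nonempty (ι ⊕ N) with he | hne
  · exact ⟨1, A.one_mem, fun i => (he.false (Sum.inl i)).elim⟩
  obtain ⟨e, he⟩ := exists_surjective_nat (ι ⊕ N)
  let s : ℕ → A × Finset N := fun n => Nat.rec (1, ∅) (fun n s => next (e n) s) n
  have hs : ∀ n, s (n + 1) = next (e n) (s n) := fun n => rfl
  have hmono : Monotone fun n => (s n).2 := monotone_nat_of_le_succ fun n => by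
    rw [hs]; exact hsub _ _
  have hagree : ∀ m n, m ≤ n → ∀ x ∈ (s m).2, (s n).1.1 x = (s m).1.1 x := by
    intro m n hmn x hx
    induction n, hmn using Nat.le_induction with
    | base => rfl
    | succ n hmn ih => rw [hs, hag _ _ x (hmono hmn hx), ih]
  have hdom : ∀ x, ∃ n, x ∈ (s n).2 ∧ (s n).1.1⁻¹ x ∈ (s n).2 := fun x => by
    obtain ⟨n, hn⟩ := he (Sum.inr x)
    refine ⟨n + 1, ?_⟩
    have := hnext (Sum.inr x) (s n)
    rw [← hn, ← hs] at this
    rw [hn] at this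
    exact this
  choose d hd hd' using hdom
  have hval : ∀ n, ∀ x ∈ (s n).2, (s (d x)).1.1 x = (s n).1.1 x := fun n x hx => by
    rcases le_total n (d x) with h | h
    · exact hagree _ _ h x hx
    · exact (hagree _ _ h x (hd x)).symm
  let k : Equiv.Perm N := Equiv.ofBijective (fun x => (s (d x)).1.1 x) <| by
    constructor
    · intro x y hxy
      dsimp only at hxy
      have h1 := hmono (le_max_left (d x) (d y)) (hd x)
      have h2 := hmono (le_max_right (d x) (d y)) (hd y)
      rw [hval _ x h1, hval _ y h2] at hxy
      exact (s _).1.1.injective hxy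
    · intro y
      refine ⟨(s (d y)).1.1⁻¹ y, ?_⟩
      dsimp only
      rw [hval _ _ (hd' y), apply_inv_self_perm]
  have hk : ∀ n, ∀ x ∈ (s n).2, k x = (s n).1.1 x := hval
  refine ⟨k, hA k fun D hD => ?_, fun i => ?_⟩
  · obtain ⟨n, hn⟩ : ∃ n, ∀ x ∈ D, x ∈ (s n).2 := by
      obtain ⟨b, hb⟩ := (hD.image d).bddAbove
      exact ⟨b, fun x hx => hmono (hb ⟨x, hx, rfl⟩) (hd x)⟩
    exact ⟨(s n).1.1, (s n).1.2, fun x hx => hk n x (hn x hx)⟩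
  · obtain ⟨n, hn⟩ := he (Sum.inl i)
    have := hnext (Sum.inl i) (s n)
    rw [← hn, ← hs] at this
    rw [hn] at this
    exact this k (hk (n + 1))

/-! ### Commutators with a map that moves every point down -/

section Commutator

variable {N : Type w} [LinearOrder N] {A : Subgroup (Equiv.Perm N)} {E : Set (Set N)}

theorem IsFreelyHomogeneous.edgeIndep_image (h : IsFreelyHomogeneous A E) {σ : Equiv.Perm N}
    (hσ : σ ∈ A) {B C D : Set N} (hi : EdgeIndep E B C D) :
    EdgeIndep E (σ '' B) (σ '' C) (σ '' D) := by
  have hm := h.strictMono σ hσ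
  refine ⟨?_, ?_, ?_⟩
  · rw [← Set.image_inter σ.injective]
    exact Set.image_mono hi.1
  · rintro s hs hsub ⟨⟨b, hbs, hb⟩, ⟨d, hds, hd⟩⟩
    rw [← Set.image_sdiff σ.injective] at hb hd
    obtain ⟨b, hb, rfl⟩ := hb
    obtain ⟨d, hd, rfl⟩ := hd
    refine hi.2.1 _ (h.edge σ⁻¹ (A.inv_mem hσ) s hs) ?_
      ⟨⟨b, ⟨_, hbs, inv_apply_self_perm σ b⟩, hb⟩, ⟨d, ⟨_, hds, inv_apply_self_perm σ d⟩, hd⟩⟩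
    rintro _ ⟨x, hx, rfl⟩
    have := hsub hx
    rw [← Set.image_union, ← Set.image_union] at this
    obtain ⟨y, hy, rfl⟩ := this
    rwa [inv_apply_self_perm]
  · rw [← Set.image_sdiff σ.injective, ← Set.image_sdiff σ.injective]
    rintro _ ⟨b, hb, rfl⟩ _ ⟨d, hd, rfl⟩ hlt
    obtain ⟨c, hc, h1, h2⟩ := hi.2.2 b hb d hd (hm.lt_iff_lt.1 hlt)
    exact ⟨σ c, ⟨c, hc, rfl⟩, hm h1, hm h2⟩

/-- If `g` moves every point down, then some commutator `[k, g]` moves every tuple, up to the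
action of the stabiliser of a finite set, to an independent tuple. -/
theorem IsFreelyHomogeneous.exists_commutator [Countable N] (h : IsFreelyHomogeneous A E)
    (hA : ∀ k : Equiv.Perm N, (∀ D : Set N, D.Finite → ∃ σ ∈ A, ∀ x ∈ D, k x = σ x) → k ∈ A)
    {g : Equiv.Perm N} (hgA : g ∈ A) (hg : ∀ z, g z < z) :
    ∃ k ∈ A, ∀ (X : Finset N) (n : ℕ) (x : Fin n → N),
      (∃ σ ∈ A, (∀ y ∈ X, σ y = y) ∧
        EdgeIndep E (Set.range (σ ∘ x)) X (Set.range ((k⁻¹ * g⁻¹ * k * g) ∘ σ ∘ x))) ∧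
      ∃ σ ∈ A, (∀ y ∈ X, σ y = y) ∧
        EdgeIndep E (Set.range ((g⁻¹ * k⁻¹ * g * k) ∘ σ ∘ x)) X (Set.range (σ ∘ x)) := by
  classical
  let P : (Finset N × Σ n, Fin n → N) ⊕ (Finset N × Σ n, Fin n → N) → Equiv.Perm N → Prop :=
    fun j k => match j with
    | .inl ⟨X, ⟨_, x⟩⟩ => ∃ σ ∈ A, (∀ y ∈ X, σ y = y) ∧
        EdgeIndep E (Set.range (σ ∘ x)) X (Set.range ((k⁻¹ * g⁻¹ * k * g) ∘ σ ∘ x))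
    | .inr ⟨X, ⟨_, x⟩⟩ => ∃ σ ∈ A, (∀ y ∈ X, σ y = y) ∧
        EdgeIndep E (Set.range ((g⁻¹ * k⁻¹ * g * k) ∘ σ ∘ x)) X (Set.range (σ ∘ x))
  obtain ⟨k, hk, hP⟩ : ∃ k ∈ A, ∀ j, P j k := by
    refine exists_forall_of_forced hA P ?_
    rintro (⟨X, n, x⟩ | ⟨X, n, x⟩) τ hτ D hD
    -- Here `γ = g⁻¹` and `Y = g '' X`. With `σ = g⁻¹ ρ g`, which fixes `X`, one has `g σ = ρ g`, so
    -- `k⁻¹ g⁻¹ k` applied to `ρ (g x)` is `[k, g] (σ x)`.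
    · obtain ⟨σ', hσ', D', hD', hag, ρ, hρ, hρY, hk⟩ := h.exists_indep_conj (A.inv_mem hgA)
        (fun z => by simpa using hg (g⁻¹ z)) hτ hD (X.finite_toSet.image g)
        ((Finset.univ.image x \ X).image g) (by
          simp only [Finset.mem_image, Finset.mem_sdiff]
          rintro _ ⟨u, ⟨-, hu⟩, rfl⟩ ⟨y, hy, hyu⟩
          exact hu (g.injective hyu ▸ hy))
      refine ⟨σ', hσ', D', hD', hag, fun k hk' => ⟨g⁻¹ * ρ * g,
        A.mul_mem (A.mul_mem (A.inv_mem hgA) hρ) hgA, fun y hy => ?_, ?_⟩⟩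
      · rw [Equiv.Perm.mul_apply, Equiv.Perm.mul_apply, hρY _ ⟨y, hy, rfl⟩, inv_apply_self_perm]
      · have hmem : ∀ l, ρ (g (x l)) ∈ g '' (X : Set N) ∪
            ρ '' ((Finset.univ.image x \ X).image g : Finset N) := by
          intro l
          by_cases hl : x l ∈ X
          · left
            rw [hρY _ ⟨_, hl, rfl⟩]
            exact ⟨_, hl, rfl⟩
          · right
            exact ⟨_, Finset.mem_image_of_mem _ (by simp [hl]), rfl⟩
        have hind := hk k hk'
        have hX : (g⁻¹ : Equiv.Perm N) '' (g '' (X : Set N)) = X := by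
          rw [← Set.image_comp]
          have : (g⁻¹ : Equiv.Perm N) ∘ g = id := funext fun z => inv_apply_self_perm g z
          rw [this, Set.image_id]
        rw [hX] at hind
        refine hind.mono ?_ ?_
        · rintro _ ⟨l, rfl⟩
          exact ⟨_, hmem l, rfl⟩
        · rintro _ ⟨l, rfl⟩
          refine ⟨_, hmem l, ?_⟩
          simp [Equiv.Perm.mul_apply]
    -- In the reversed order `g` moves points up, so `γ = g` and `Y = X` are allowed; swapping the
    -- sides and translating by `g⁻¹` gives the claim.
    · obtain ⟨σ', hσ', D', hD', hag, ρ, hρ, hρY, hk⟩ :=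
        @IsFreelyHomogeneous.exists_indep_conj N (reverseOrder inferInstance) A E h.swap
        g hgA hg τ hτ D X hD X.finite_toSet (Finset.univ.image x \ X) (by simp)
      refine ⟨σ', hσ', D', hD', hag, fun k hk' => ⟨ρ, hρ, hρY, ?_⟩⟩
      have hmem : ∀ l, ρ (x l) ∈ (X : Set N) ∪ ρ '' (Finset.univ.image x \ X : Finset N) := by
        intro l
        by_cases hl : x l ∈ X
        · left
          rwa [hρY _ hl]
        · right
          exact ⟨_, by simp [hl], rfl⟩
      have hind := h.edgeIndep_image (A.inv_mem hgA) (hk k hk').swap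
      have hX : ∀ B : Set N, (g⁻¹ : Equiv.Perm N) '' (g '' B) = B := fun B => by
        rw [← Set.image_comp]
        have : (g⁻¹ : Equiv.Perm N) ∘ g = id := funext fun z => inv_apply_self_perm g z
        rw [this, Set.image_id]
      rw [hX, hX] at hind
      refine hind.mono ?_ ?_
      · rintro _ ⟨l, rfl⟩
        exact ⟨_, ⟨_, hmem l, rfl⟩, rfl⟩
      · rintro _ ⟨l, rfl⟩
        exact hmem l
  exact ⟨k, hk, fun X n x => ⟨hP (.inl ⟨X, ⟨n, x⟩⟩), hP (.inr ⟨X, ⟨n, x⟩⟩)⟩⟩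

end Commutator

/-! ### Automorphisms of relational structures -/

section Automorphisms

variable (L : FirstOrder.Language.{u, v}) (N : Type w) [L.Structure N]

/-- The permutations that preserve all relations of a structure. -/
def relAut : Subgroup (Equiv.Perm N) where
  carrier := {σ | ∀ (n : ℕ) (R : L.Relations n) (t : Fin n → N), RelMap R (σ ∘ t) ↔ RelMap R t}
  mul_mem' {σ τ} hσ hτ n R t := (hσ n R (τ ∘ t)).trans (hτ n R t)
  one_mem' _ _ _ := Iff.rfl
  inv_mem' {σ} hσ n R t := by
    rw [← hσ n R (⇑σ⁻¹ ∘ t)]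
    have : σ ∘ ⇑σ⁻¹ ∘ t = t := funext fun i => apply_inv_self_perm σ (t i)
    rw [this]

variable {L N}

theorem toEquiv_mem_relAut (f : N ≃[L] N) : f.toEquiv ∈ relAut L N :=
  fun _ R t => f.map_rel' R t

/-- A permutation that preserves all relations of a relational structure is an automorphism. -/
def relAutToEquiv [L.IsRelational] (σ : Equiv.Perm N) (hσ : σ ∈ relAut L N) : N ≃[L] N :=
  { σ with
    map_fun' := fun f => isEmptyElim f
    map_rel' := fun R t => hσ _ R t }

/-- Each instance of a relation involves only finitely many points, so a pointwise limit preserves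
it. -/
theorem relAut_closed (k : Equiv.Perm N)
    (hk : ∀ D : Set N, D.Finite → ∃ σ ∈ relAut L N, ∀ x ∈ D, k x = σ x) : k ∈ relAut L N := by
  intro n R t
  obtain ⟨σ, hσ, h⟩ := hk (Set.range t) (Set.finite_range t)
  have : k ∘ t = σ ∘ t := funext fun i => h _ ⟨i, rfl⟩
  rw [this]
  exact hσ n R t

theorem tp_comp_of_fixes (f : N ≃[L] N) {X : Set N} (hf : ∀ x ∈ X, f x = x) {n : ℕ}
    (x : Fin n → N) : tp L (f ∘ x) X = tp L x X := by
  let f' : N ≃[L[[X]]] N :=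
    { f.toEquiv with
      map_fun' := by
        rintro n (F | F) t
        · exact f.map_fun' F t
        · match n, F with
          | 0, F => exact hf F.1 F.2
          | _ + 1, F => exact isEmptyElim F
      map_rel' := by
        rintro n (R | R) t
        · exact f.map_rel' R t
        · exact isEmptyElim R }
  ext φ
  exact FirstOrder.Language.StrongHomClass.realize_formula f' φ

/-- The structure induced on a subset of a relational structure. -/
abbrev inducedOn [L.IsRelational] (P : Set N) : L.Structure P where
  funMap f := isEmptyElim f
  RelMap R t := RelMap R (fun i => (t i : N))

theorem exists_relAut_of_partial [L.IsRelational] (hN : L.IsUltrahomogeneous N) {P : Set N}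
    (hP : P.Finite) (φ : P → N) (hinj : Function.Injective φ)
    (hφ : ∀ (n : ℕ) (R : L.Relations n) (t : Fin n → P),
      RelMap R (φ ∘ t) ↔ RelMap R (fun i => (t i : N))) :
    ∃ σ ∈ relAut L N, ∀ x : P, σ x = φ x := by
  let S : L.Substructure N := ⟨P, fun f => isEmptyElim f⟩
  have : Finite S := hP
  obtain ⟨f, hf⟩ := hN S (FirstOrder.Language.Substructure.FG.of_finite)
    { toFun := φ, inj' := hinj, map_fun' := fun f => isEmptyElim f, map_rel' := fun R t => hφ _ R t }
  refine ⟨f.toEquiv, toEquiv_mem_relAut f, fun x => ?_⟩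
  exact (DFunLike.congr_fun hf x).symm

end Automorphisms

/-! ### The linear order expansion -/

section Expansion

variable {L : FirstOrder.Language.{u, v}} {N : Type w} [(withLt L).Structure N]

variable (L N) in
/-- The ranges of the tuples that satisfy a relation of `L`. -/
def edges : Set (Set N) :=
  {s | ∃ (n : ℕ) (R : L.Relations n) (t : Fin n → N), rel L R t ∧ s = Set.range t}

theorem rel_comp_iff {σ : Equiv.Perm N} (hσ : σ ∈ relAut (withLt L) N) {n : ℕ}
    (R : L.Relations n) (t : Fin n → N) : rel L R (σ ∘ t) ↔ rel L R t :=
  hσ n _ t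

theorem lt_iff_of_relMap {P : Type*} {φ ψ : P → N} :
    (∀ t : Fin 2 → P, RelMap (ltSymb L) (φ ∘ t) ↔ RelMap (ltSymb L) (ψ ∘ t)) ↔
      ∀ x y, lt L (φ x) (φ y) ↔ lt L (ψ x) (ψ y) := by
  have key : ∀ (χ : P → N) (t : Fin 2 → P), χ ∘ t = ![χ (t 0), χ (t 1)] := fun χ t => by
    funext i; fin_cases i <;> rfl
  constructor
  · intro h x y
    have := h ![x, y]
    rw [key, key] at this
    exact this
  · intro h t
    rw [key, key]
    exact h _ _

theorem lt_apply_iff {σ : Equiv.Perm N} (hσ : σ ∈ relAut (withLt L) N) (x y : N) :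
    lt L (σ x) (σ y) ↔ lt L x y :=
  lt_iff_of_relMap (φ := σ) (ψ := id) |>.1 (fun t => hσ 2 _ t) x y

theorem indep_of_edgeIndep [LinearOrder N] (hlt : ∀ a b : N, a < b ↔ lt L a b) {A B C : Set N}
    (h : EdgeIndep (edges L N) A B C) : Indep L A B C := by
  refine ⟨h.1, ?_, ?_⟩
  · rintro n R t ht hR ⟨⟨i, hi⟩, ⟨j, hj⟩⟩
    exact h.2.1 _ ⟨n, R, t, hR, rfl⟩ ht ⟨⟨_, ⟨i, rfl⟩, hi⟩, ⟨_, ⟨j, rfl⟩, hj⟩⟩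
  · intro a ha c hc hac
    obtain ⟨b, hb, h1, h2⟩ := h.2.2 a ha c hc ((hlt _ _).2 hac)
    exact ⟨b, hb, (hlt _ _).1 h1, (hlt _ _).1 h2⟩

variable [L.IsRelational]

theorem exists_relAut_of_partial_withLt [LinearOrder N] (hlt : ∀ a b : N, a < b ↔ lt L a b)
    (hN : (withLt L).IsUltrahomogeneous N) {P : Set N} (hP : P.Finite) (φ : P → N)
    (hφ : ∀ (n : ℕ) (R : L.Relations n) (t : Fin n → P),
      rel L R (φ ∘ t) ↔ rel L R (fun i => (t i : N)))
    (hφlt : StrictMono φ) : ∃ σ ∈ relAut (withLt L) N, ∀ x : P, σ x = φ x := by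
  refine exists_relAut_of_partial hN hP φ hφlt.injective ?_
  rintro n (R | R) t
  · exact hφ n R t
  · cases R
    exact lt_iff_of_relMap (φ := φ) (ψ := fun x : P => (x : N)) |>.2
      (fun x y => by rw [← hlt, ← hlt]; exact hφlt.lt_iff_lt) t

attribute [local instance] inducedOn

theorem lt_inducedOn {P : Set N} (x y : P) : lt L x y ↔ lt L (x : N) (y : N) := by
  change RelMap (ltSymb L) _ ↔ RelMap (ltSymb L) _
  have : (fun i => ((![x, y] i : P) : N)) = ![(x : N), (y : N)] := by
    funext i; fin_cases i <;> rfl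
  rw [← this]
  exact Iff.rfl

variable {M : Type w} [L.Structure M] [Countable N]

theorem inducedOn_mem (hN : IsLinearOrderExpansion L M N) {P : Set N} (hP : P.Finite) :
    (⟨P, inducedOn P⟩ : CategoryTheory.Bundled.{w} (withLt L).Structure) ∈
      orderExpansions (L.age M) := by
  rw [← hN.age]
  have : Finite P := hP
  refine ⟨FirstOrder.Language.Structure.FG.of_finite, ⟨?_⟩⟩
  exact { toFun := Subtype.val, inj' := Subtype.val_injective, map_fun' := fun f => isEmptyElim f,
          map_rel' := fun _ _ => Iff.rfl }

/-- The axioms involve at most three points, and finite induced substructures of `N` belong to the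
class of ordered expansions. -/
theorem isStrictTotalOrder_lt (hN : IsLinearOrderExpansion L M N) :
    IsStrictTotalOrder N (lt L) := by
  have key : ∀ a b c : N, IsStrictTotalOrder ({a, b, c} : Set N) (lt L) := fun a b c =>
    (inducedOn_mem hN (Set.toFinite {a, b, c})).2
  refine { irrefl := fun a ha => ?_, trans := fun a b c hab hbc => ?_,
           trichotomous := fun a b hab hba => ?_ }
  · have := key a b b
    have := this.trichotomous (⟨a, by simp⟩ : ({a, b, b} : Set N)) ⟨b, by simp⟩
      (fun h => hab ((lt_inducedOn _ _).1 h)) (fun h => hba ((lt_inducedOn _ _).1 h))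
    exact congrArg Subtype.val this
  · have := key a a a
    exact irrefl_of (lt L) (⟨a, by simp⟩ : ({a, a, a} : Set N)) ((lt_inducedOn _ _).2 ha)
  · have := key a b c
    have := trans_of (lt L) (a := (⟨a, by simp⟩ : ({a, b, c} : Set N))) (b := ⟨b, by simp⟩)
      (c := ⟨c, by simp⟩) ((lt_inducedOn _ _).2 hab) ((lt_inducedOn _ _).2 hbc)
    exact (lt_inducedOn _ _).1 this

/-- The expansion of an `L`-structure by the order pulled back along a map to `ℚ`. -/
abbrev pullbackLt {D : Type w} (ρ : D → ℚ) : ltLang.Structure D where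
  funMap f := isEmptyElim f
  RelMap R t := match R with
    | .lt => ρ (t 0) < ρ (t 1)

/-- The class contains every linear order on a member of the age; the injection `ρ` into `ℚ` encodes
the chosen order. -/
theorem exists_embedding_of_injective (hN : IsLinearOrderExpansion L M N) {D : Type w}
    [L.Structure D] (hD : (⟨D, inferInstance⟩ : CategoryTheory.Bundled.{w} L.Structure) ∈ L.age M)
    (ρ : D → ℚ) (hρ : Function.Injective ρ) :
    ∃ e : D → N, Function.Injective e ∧
      (∀ (n : ℕ) (R : L.Relations n) (t : Fin n → D), rel L R (e ∘ t) ↔ RelMap R t) ∧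
      ∀ x y, lt L (e x) (e y) ↔ ρ x < ρ y := by
  let := pullbackLt ρ
  have hmem : (⟨D, inferInstance⟩ : CategoryTheory.Bundled.{w} (withLt L).Structure) ∈
      orderExpansions (L.age M) := by
    refine ⟨hD, ?_⟩
    exact { irrefl := fun a => lt_irrefl (ρ a), trans := fun a b c => lt_trans (a := ρ a),
            trichotomous := fun a b h1 h2 => hρ (le_antisymm (not_lt.1 h2) (not_lt.1 h1)) }
  rw [← hN.age] at hmem
  obtain ⟨-, ⟨e⟩⟩ := hmem
  refine ⟨e, e.injective, fun n R t => e.map_rel' _ t, fun x y => ?_⟩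
  have := e.map_rel' (ltSymb L) ![x, y]
  have h2 : (e.toFun ∘ ![x, y]) = ![e x, e y] := by
    funext i; fin_cases i <;> rfl
  rw [h2] at this
  exact this

end Expansion

/-! ### Free one-point extensions with a prescribed cut -/

section FreeExtension

variable {L : FirstOrder.Language.{u, v}} [L.IsRelational] {M : Type w} [L.Structure M]
  [Countable M] {N : Type w} [(withLt L).Structure N] [Countable N] [LinearOrder N]

/-- Over a finite set `S`, a point `a ∉ S` can be moved by an automorphism to a point that is free
from `T` and realises any cut of `T` that is compatible with the position of `a` over `S`. -/
theorem exists_free_of_cut (hfree : IsFreeHomogeneous L M) (hN : IsLinearOrderExpansion L M N)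
    (hlt : ∀ a b : N, a < b ↔ lt L a b) {S T : Set N} (hT : T.Finite) (hST : S ⊆ T) {a : N}
    (haS : a ∉ S) {τ : N → ℚ} (hτ : StrictMono τ) {q : ℚ} (hq : ∀ t ∈ T, τ t ≠ q)
    (hSq : ∀ s ∈ S, s < a ↔ τ s < q) :
    ∃ σ ∈ relAut (withLt L) N, (∀ s ∈ S, σ s = s) ∧ σ a ∉ T ∧
      FreeFrom (edges L N) {σ a} T S ∧ ∀ t ∈ T, t < σ a ↔ τ t < q := by
  classical
  obtain ⟨K, ⟨hK, hamalg⟩, hM⟩ := hfree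
  have hage : L.age M = K := hM.age
  have hS : S.Finite := hT.subset hST
  let str : ∀ P : Set N, L.Structure P := fun P =>
    @LHom.reduct L (withLt L) LHom.sumInl P (inducedOn P)
  let B : Set N → CategoryTheory.Bundled.{w} L.Structure := fun P => ⟨P, str P⟩
  have hB : ∀ P : Set N, P.Finite → B P ∈ K := fun P hP => hage ▸ (inducedOn_mem hN hP).1
  let C : Set N := insert a S
  have hC : C.Finite := hS.insert a
  let f : B S ↪[L] B T :=
    { toFun := Set.inclusion hST, inj' := Set.inclusion_injective hST,
      map_fun' := fun f => isEmptyElim f, map_rel' := fun _ _ => Iff.rfl }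
  let g : B S ↪[L] B C :=
    { toFun := Set.inclusion (Set.subset_insert a S), inj' := Set.inclusion_injective _,
      map_fun' := fun f => isEmptyElim f, map_rel' := fun _ _ => Iff.rfl }
  -- The free amalgam of `T` and `S ∪ {a}` over `S` is `T` with one new point `j a₀`, which will be
  -- ordered at height `q`.
  obtain ⟨D, hD, i, j, hcomm, hcover, hinter, hrel⟩ :=
    hamalg (B S) (B T) (B C) f g (hB S hS) (hB T hT) (hB C hC)
  have hij : ∀ s (hs : s ∈ S), i ⟨s, hST hs⟩ = j ⟨s, Or.inr hs⟩ := fun s hs =>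
    DFunLike.congr_fun hcomm (⟨s, hs⟩ : S)
  let a₀ : C := ⟨a, Or.inl rfl⟩
  have haC : ∀ x : C, x = a₀ ∨ ∃ hs : (x : N) ∈ S, x = ⟨x, Or.inr hs⟩ := by
    rintro ⟨x, rfl | hx⟩
    exacts [Or.inl rfl, Or.inr ⟨hx, rfl⟩]
  have hmeet : ∀ t : T, i t ∈ Set.range j → (t : N) ∈ S := by
    intro t ht
    obtain ⟨s, hs⟩ := hinter ⟨⟨t, rfl⟩, ht⟩
    have : f s = t := i.injective hs
    rw [← this]
    exact s.2
  have hja : ∀ t : T, i t ≠ j a₀ := by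
    intro t ht
    have hs := hmeet t ⟨a₀, ht.symm⟩
    have h1 := hij t hs
    rw [show (⟨(t : N), hST hs⟩ : T) = t from rfl, ht] at h1
    have h2 : a = (t : N) := congrArg Subtype.val (j.injective h1)
    exact haS (h2 ▸ hs)
  have hD' : ∀ d : D, (∃ t : T, d = i t) ∨ d = j a₀ := by
    intro d
    have hd : d ∈ Set.range i ∪ Set.range j := hcover ▸ Set.mem_univ d
    rcases hd with ⟨t, rfl⟩ | ⟨x, rfl⟩
    · exact Or.inl ⟨t, rfl⟩
    · rcases haC x with rfl | ⟨hs, hx⟩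
      · exact Or.inr rfl
      · rw [hx, ← hij x hs]
        exact Or.inl ⟨_, rfl⟩
  let ρ : D → ℚ := fun d => if h : ∃ t : T, d = i t then τ h.choose else q
  have hρi : ∀ t : T, ρ (i t) = τ t := by
    intro t
    have h : ∃ t' : T, i t = i t' := ⟨t, rfl⟩
    have h2 : h.choose = t := (i.injective h.choose_spec).symm
    simp only [ρ, dif_pos h, h2]
  have hρa : ρ (j a₀) = q := dif_neg fun ⟨t, ht⟩ => hja t ht.symm
  have hρ : Function.Injective ρ := by
    intro x y hxy
    rcases hD' x with ⟨t, rfl⟩ | rfl <;> rcases hD' y with ⟨t', rfl⟩ | rfl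
    · rw [hρi, hρi] at hxy
      rw [Subtype.ext (hτ.injective hxy)]
    · rw [hρi, hρa] at hxy
      exact absurd hxy (hq t t.2)
    · rw [hρi, hρa] at hxy
      exact absurd hxy.symm (hq t' t'.2)
    · rfl
  obtain ⟨e, hinj, herel, helt⟩ := exists_embedding_of_injective hN (D := D) (hage ▸ hD) ρ hρ
  -- The copy of `T` in the embedded amalgam is carried back to `T` by `σ₁⁻¹`, so the new point
  -- becomes a point of `N` placed over `T` itself.
  obtain ⟨σ₁, hσ₁, hσ₁T⟩ := exists_relAut_of_partial_withLt hlt hN.ultrahomogeneous hT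
    (fun t => e (i t)) (fun n R t => (herel n R (i ∘ t)).trans (i.map_rel' R t))
    (fun x y hxy => by
      rw [hlt, helt, hρi, hρi]
      exact hτ hxy)
  have hσ₁' := (relAut (withLt L) N).inv_mem hσ₁
  have hσlt : ∀ x y, σ₁⁻¹ x < σ₁⁻¹ y ↔ x < y := fun x y => by
    rw [hlt, hlt]; exact lt_apply_iff hσ₁' x y
  have hρC : ∀ x y : C, x < y → ρ (j x) < ρ (j y) := by
    intro x y hxy
    rcases haC x with rfl | ⟨hx, hx'⟩ <;> rcases haC y with rfl | ⟨hy, hy'⟩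
    · exact absurd hxy (lt_irrefl _)
    · rw [hy', ← hij y hy, hρa, hρi]
      refine lt_of_le_of_ne (not_lt.1 fun hc => ?_) (hq y (hST hy)).symm
      exact lt_asymm ((hSq y hy).2 hc) hxy
    · rw [hx', ← hij x hx, hρa, hρi]
      exact (hSq x hx).1 hxy
    · rw [hx', hy', ← hij x hx, ← hij y hy, hρi, hρi]
      exact hτ hxy
  obtain ⟨σ, hσ, hσC⟩ := exists_relAut_of_partial_withLt hlt hN.ultrahomogeneous hC
    (fun x => σ₁⁻¹ (e (j x)))
    (fun n R t => (rel_comp_iff hσ₁' R (e ∘ j ∘ t)).trans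
      ((herel n R (j ∘ t)).trans (j.map_rel' R t)))
    (fun x y hxy => by
      rw [hσlt, hlt, helt]
      exact hρC x y hxy)
  have hσa : σ₁ (σ a) = e (j a₀) := by rw [hσC a₀, apply_inv_self_perm]
  have haT : σ a ∉ T := by
    intro hc
    have := hσ₁T ⟨_, hc⟩
    rw [hσa] at this
    exact hja _ (hinj this).symm
  refine ⟨σ, hσ, fun s hs => ?_, haT, ?_, fun t ht => ?_⟩
  · have h1 := hσC ⟨s, Or.inr hs⟩
    rw [← hij s hs, ← hσ₁T ⟨s, hST hs⟩, inv_apply_self_perm] at h1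
    exact h1
  · rintro s ⟨n, R, t, hR, rfl⟩ hsub ⟨_, ⟨l₀, rfl⟩, hl₀⟩
    have hl₀' : t l₀ = σ a := hl₀
    have hlift : ∀ l, ∃ d : D, σ₁ (t l) = e d := by
      intro l
      rcases hsub ⟨l, rfl⟩ with hl | hl
      · exact ⟨i ⟨t l, hl⟩, hσ₁T ⟨t l, hl⟩⟩
      · exact ⟨j a₀, by rw [← hσa, show t l = σ a from hl]⟩
    choose d hd using hlift
    have hdR : RelMap R d := by
      rw [← herel]
      have : e ∘ d = σ₁ ∘ t := funext fun l => (hd l).symm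
      rw [this]
      exact (rel_comp_iff hσ₁ R t).2 hR
    have hd₀ : d l₀ = j a₀ := hinj (by rw [← hd, hl₀', hσa])
    have hj : Set.range d ⊆ Set.range j := by
      refine (hrel n R d hdR).resolve_left fun hc => ?_
      obtain ⟨t', ht'⟩ := hc ⟨l₀, rfl⟩
      exact hja t' (ht'.trans hd₀)
    rw [Set.disjoint_left]
    rintro _ ⟨l, rfl⟩ ⟨hlT, hlS⟩
    have hdl : d l = i ⟨t l, hlT⟩ := hinj (by rw [← hd]; exact hσ₁T ⟨t l, hlT⟩)
    exact hlS (hmeet ⟨t l, hlT⟩ (hdl ▸ hj ⟨l, rfl⟩))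
  · rw [hlt, ← lt_apply_iff hσ₁, hσa, hσ₁T ⟨t, ht⟩, helt, hρi, hρa]

theorem isFreelyHomogeneous_relAut (hfree : IsFreeHomogeneous L M)
    (hN : IsLinearOrderExpansion L M N) (hlt : ∀ a b : N, a < b ↔ lt L a b) :
    IsFreelyHomogeneous (relAut (withLt L) N) (edges L N) := by
  classical
  refine ⟨fun σ hσ a b hab => ?_, ?_, ?_⟩
  · rw [hlt] at hab ⊢
    exact (lt_apply_iff hσ a b).2 hab
  · rintro σ hσ _ ⟨n, R, t, hR, rfl⟩
    exact ⟨n, R, σ ∘ t, (rel_comp_iff hσ R t).2 hR, (Set.range_comp _ _).symm⟩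
  · intro S T Lo Hi a hT hLo hHi hST haS h1 h2 h3
    obtain ⟨τ⟩ := Order.embedding_from_countable_to_dense N ℚ
    let T' : Set N := T ∪ Lo ∪ Hi
    have hT' : T'.Finite := (hT.union hLo).union hHi
    -- The lower half of the cut is generated by `Lo` and the points of `S` below `a`; the
    -- compatibility hypotheses keep `Hi` and the points of `S` above `a` out of it.
    let low : N → Prop := fun t => ∃ l ∈ Lo ∪ {s ∈ S | s < a}, t ≤ l
    obtain ⟨q, hql, hqh⟩ := Order.exists_between_finsets
      ((hT'.subset (Set.sep_subset T' low)).toFinset.image τ)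
      ((hT'.subset (Set.sep_subset T' fun t => ¬ low t)).toFinset.image τ) (by
        simp only [Finset.mem_image, Set.Finite.mem_toFinset]
        rintro _ ⟨x, ⟨-, l, hl, hxl⟩, rfl⟩ _ ⟨y, ⟨-, hy⟩, rfl⟩
        rw [τ.lt_iff_lt]
        by_contra hc
        exact hy ⟨l, hl, (not_lt.1 hc).trans hxl⟩)
    have hlow : ∀ t ∈ T', low t → τ t < q := fun t ht hl =>
      hql _ (Finset.mem_image_of_mem _ (by simpa using ⟨ht, hl⟩))
    have hhigh : ∀ t ∈ T', ¬ low t → q < τ t := fun t ht hl =>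
      hqh _ (Finset.mem_image_of_mem _ (by simpa using ⟨ht, hl⟩))
    have hHi' : ∀ t ∈ Hi, ¬ low t := by
      rintro t ht ⟨l, hl | ⟨hl, hla⟩, htl⟩
      · exact (h1 l hl t ht).not_ge htl
      · exact (h2 l hl hla t ht).not_ge htl
    have hS' : ∀ s ∈ S, a < s → ¬ low s := by
      rintro s hs has ⟨l, hl | ⟨hl, hla⟩, htl⟩
      · exact (h3 s hs has l hl).not_ge htl
      · exact (hla.trans has).not_ge htl
    obtain ⟨σ, hσ, hσS, hσT, hσF, hσq⟩ := exists_free_of_cut hfree hN hlt hT'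
      (hST.trans (Set.subset_union_left.trans Set.subset_union_left)) haS τ.strictMono (q := q)
      (fun t ht => by
        by_cases hl : low t
        exacts [(hlow t ht hl).ne, (hhigh t ht hl).ne'])
      (fun s hs => by
        have hs' : s ∈ T' := Or.inl (Or.inl (hST hs))
        constructor
        · exact fun hsa => hlow s hs' ⟨s, Or.inr ⟨hs, hsa⟩, le_rfl⟩
        · intro hsq
          by_contra hc
          have has : a < s := lt_of_le_of_ne (not_lt.1 hc) fun he => haS (he ▸ hs)
          exact lt_asymm hsq (hhigh s hs' (hS' s hs has)))
    refine ⟨σ, hσ, hσS, fun hc => hσT (Or.inl (Or.inl hc)), ?_, ?_, ?_⟩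
    · intro s hs hsub hne
      refine (hσF s hs (hsub.trans (Set.union_subset_union_left _ ?_)) hne).mono_right
        (Set.sdiff_subset_sdiff_left ?_) <;>
      exact Set.subset_union_left.trans Set.subset_union_left
    · intro l hl
      have hl' : l ∈ T' := Or.inl (Or.inr hl)
      exact (hσq l hl').2 (hlow l hl' ⟨l, Or.inl hl, le_rfl⟩)
    · intro t ht
      have ht' : t ∈ T' := Or.inr ht
      refine lt_of_le_of_ne (not_lt.1 fun hc => ?_) fun he => hσT (he ▸ ht')
      exact lt_asymm ((hσq t ht').1 hc) (hhigh t ht' (hHi' t ht))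

end FreeExtension

end LinExp
theorem mainTheorem4 (L : FirstOrder.Language.{u, v}) [L.IsRelational]
    (M : Type w) [L.Structure M] [Countable M]
    (hfree : LinExp.IsFreeHomogeneous L M) (hnontriv : LinExp.IsNontrivial L M)
    (N : Type w) [(LinExp.withLt L).Structure N] [Countable N]
    (hN : LinExp.IsLinearOrderExpansion L M N)
    (g : N ≃[LinExp.withLt L] N) (hg : ∀ a : N, LinExp.lt L (g a) a) :
    ∃ k : N ≃[LinExp.withLt L] N,
      LinExp.MovesAlmostRMaximally (LinExp.Indep L) (LinExp.comm k g) ∧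
      LinExp.MovesAlmostLMaximally (LinExp.Indep L) (LinExp.comm g k) := by
  classical
  have hord := LinExp.isStrictTotalOrder_lt hN
  let := linearOrderOfSTO (LinExp.lt L (N := N))
  have hlt : ∀ a b : N, a < b ↔ LinExp.lt L a b := fun _ _ => Iff.rfl
  obtain ⟨k, hk, hmove⟩ := (LinExp.isFreelyHomogeneous_relAut hfree hN hlt).exists_commutator
    LinExp.relAut_closed (LinExp.toEquiv_mem_relAut g) hg
  refine ⟨LinExp.relAutToEquiv k hk, fun X hX n x => ?_, fun X hX n x => ?_⟩
  · obtain ⟨⟨σ, hσ, hσX, hind⟩, -⟩ := hmove hX.toFinset n x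
    rw [hX.coe_toFinset] at hind
    exact ⟨σ ∘ x, LinExp.tp_comp_of_fixes (LinExp.relAutToEquiv σ hσ)
      (fun y hy => hσX y (hX.mem_toFinset.2 hy)) x, LinExp.indep_of_edgeIndep hlt hind⟩
  · obtain ⟨-, ⟨σ, hσ, hσX, hind⟩⟩ := hmove hX.toFinset n x
    rw [hX.coe_toFinset] at hind
    exact ⟨σ ∘ x, LinExp.tp_comp_of_fixes (LinExp.relAutToEquiv σ hσ)
      (fun y hy => hσX y (hX.mem_toFinset.2 hy)) x, LinExp.indep_of_edgeIndep hlt hind⟩
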